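/- Let $K$ be a field of characteristic $0$ and $A=\{1<2<3<\cdots\}$ the alphabet of positive integers. Let $K\langle A\rangle$ be the projective limit of the free associative algebras $K\langle B\rangle$ over the finite subsets $B\subset A$ (the maps sending the omitted letters to $0$), i.e. the algebra, under concatenation, of formal sums of words whose restriction to each finite $B$ is a polynomial; let $K\langle A\rangle^+$ be the ideal of elements without constant term. For a word $w$ with set of letters $b_1<\dots<b_r$, let $\mathrm{pack}(w)$ be the word obtained by replacing each $b_i$ by $i$; a word $u$ is packed if $\mathrm{pack}(u)=u$. Put $M_u=\sum_{\mathrm{pack}(w)=u}w$; in particular $M_1=\sum_{a\in A}a$. On $K\langle A\rangle^+$ consider the three operations determined on nonempty words by: $u\prec v$ (resp. $u\circ v$, $u\succ v$) is $uv$ if $\max u>\max v$ (resp. $\max u=\max v$, $\max u<\max v$) and $0$ otherwise; their sum is the product. Let $TD$ be the smallest subspace of $K\langle A\rangle^+$ that contains $M_1$ and is stable under $\prec,\circ,\succ$ (a dendriform trialgebra, in particular a nonunital algebra). A segmented composition is a nonempty finite sequence of positive integers in which consecutive terms are separated by a comma or a bar. Those of sum $n\ge1$ correspond bijectively to sequences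 $s_1\cdots s_{n-1}$ of signs $<,=,>$: with $p_1,p_2,\dots$ the terms, $s_i$ is $=$ (resp. $>$) if $i=p_1+\dots+p_k$ and $p_k$ is followed by a comma (resp. a bar), and $<$ otherwise. For a word $w=w_1\cdots w_n$ with $n\ge1$, $SC(w)$ is the segmented composition whose $i$-th sign is the comparison sign between $w_i$ and $w_{i+1}$. For segmented compositions $I',I''$, let $I',I''$ and $I'|I''$ be their concatenations with a comma, resp. a bar, in between, and $I'\triangleright I''$ the one in which the last term of $I'$ and the first term of $I''$ are replaced by their sum. Put $MC_I=\sum_{u}M_u$, over the (finitely many) nonempty packed words $u$ with $SC(u)=I$. **Theorem.** The elements $MC_I$ are linearly independent, and their linear span $TC$ is a (nonunital) subalgebra of $TD$, equal to the subalgebra generated by the $MC_I$. For all segmented compositions $I',I''$, $$MC_{I'}\,MC_{I''}=MC_{I'\triangleright I''}+MC_{I',I''}+MC_{I'|I''}.$$ Moreover the bilinear operations on $TC$ given by $MC_{I'}\vdash MC_{I''}=MC_{I'\triangleright I''}$, $MC_{I'}\perp MC_{I''}=MC_{I',I''}$, $MC_{I'}\dashv MC_{I''}=MC_{I'|I''}$,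 whose sum is the product of $TC$, make $TC$ the free cubical trialgebra on the one generator $MC_{1}=M_1$. Here a cubical trialgebra is a vector space with three bilinear operations $\dashv,\perp,\vdash$ such that $(x\circ_1y)\circ_2z=x\circ_1(y\circ_2z)$ for all $\circ_1,\circ_2\in\{\dashv,\perp,\vdash\}$, and freeness means: for every cubical trialgebra $W$ over $K$ and every $b\in W$ there is exactly one linear map $TC\to W$ that respects the three operations and sends $MC_{1}$ to $b$. -/

import Mathlib

universe w u v

namespace WQ

/-! ### Words and packing -/

/-- Words over the infinite ordered alphabet `A = {1 < 2 < 3 < ⋯}`. -/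
abbrev Word := List ℕ+

/-- `pack w`: if `b₁ < ⋯ < b_r` are the letters occurring in `w`, replace each `b_i` by `i`
(the successor of the number of letters of `w` that are smaller than `b_i`). -/
def pack (w : Word) : Word :=
  w.map fun b => Nat.succPNat (w.toFinset.filter (· < b)).card

/-- A word is packed if it is its own packed word. -/
def IsPacked (u : Word) : Prop := pack u = u

theorem length_pack (w : Word) : (pack w).length = w.length := by simp [pack]

theorem finite_words (B : Finset ℕ+) (n : ℕ) :
    {w : Word | (∀ a ∈ w, a ∈ B) ∧ w.length = n}.Finite := by
  refine ((List.finite_length_eq (↥B) n).image (List.map Subtype.val)).subset ?_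
  rintro w ⟨hw, hn⟩
  refine ⟨w.attach.map fun a => ⟨a.1, hw a.1 a.2⟩, by simpa using hn, ?_⟩
  simp [List.map_map, Function.comp_def]

theorem le_length_of_isPacked {u : Word} (hu : IsPacked u) {a : ℕ+} (ha : a ∈ u) :
    (a : ℕ) ≤ u.length := by
  have hu' : pack u = u := hu
  rw [← hu'] at ha
  obtain ⟨b, hb, rfl⟩ := List.mem_map.1 ha
  have h1 : (u.toFinset.filter (· < b)).card < u.toFinset.card :=
    Finset.card_lt_card (Finset.filter_ssubset.2 ⟨b, by simpa using hb, lt_irrefl b⟩)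
  have h2 := List.toFinset_card_le u
  simp only [Nat.succPNat_coe]
  omega

/-! ### The algebra `K⟨A⟩` over the infinite alphabet -/

section Series

variable (K : Type*) [CommRing K]

/-- Formal noncommutative series in the letters of `A`: all functions from words to `K`. -/
def Series : Type _ := Word → K

instance : AddCommGroup (Series K) := inferInstanceAs (AddCommGroup (Word → K))

instance : Module K (Series K) := inferInstanceAs (Module K (Word → K))

variable {K}

open Classical in
/-- The part of the concatenation product that keeps, among the products `u · v` of words, those
with `P u v`: the coefficient of `w` is the sum of `f u * g v` over all factorizations `w = u v`
with `P u v`. -/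
noncomputable def splitProd (P : Word → Word → Prop) (f g : Series K) : Series K := fun w =>
  ∑ k ∈ Finset.range (w.length + 1),
    if P (w.take k) (w.drop k) then f (w.take k) * g (w.drop k) else 0

/-- The concatenation product. -/
noncomputable instance : Mul (Series K) := ⟨splitProd fun _ _ => True⟩

/-- The empty word. -/
instance : One (Series K) := ⟨fun w => if w = [] then 1 else 0⟩

theorem Series.mul_apply (f g : Series K) (w : Word) :
    (f * g) w = ∑ k ∈ Finset.range (w.length + 1), f (w.take k) * g (w.drop k) := by
  change splitProd (fun _ _ => True) f g w = _
  simp [splitProd]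

theorem Series.one_apply (w : Word) : (1 : Series K) w = if w = [] then 1 else 0 := rfl

theorem Series.add_apply (f g : Series K) (w : Word) : (f + g) w = f w + g w := rfl

theorem Series.smul_apply (c : K) (f : Series K) (w : Word) : (c • f) w = c * f w := rfl

theorem Series.zero_apply (w : Word) : (0 : Series K) w = 0 := rfl

theorem Series.mul_nil (f g : Series K) : (f * g) [] = f [] * g [] := by
  simp [Series.mul_apply]

/-- The series of all words `v`, with the coefficient of `a v` in `f`. -/
def Series.shift (a : ℕ+) (f : Series K) : Series K := fun v => f (a :: v)

theorem Series.mul_cons (f g : Series K) (a : ℕ+) (w : Word) :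
    (f * g) (a :: w) = (f.shift a * g) w + f [] * g (a :: w) := by
  simp [Series.mul_apply, Series.shift, Finset.sum_range_succ' _ (w.length + 1)]

protected theorem Series.left_distrib (f g h : Series K) : f * (g + h) = f * g + f * h := by
  funext w
  simp [Series.mul_apply, Series.add_apply, mul_add, Finset.sum_add_distrib]

protected theorem Series.right_distrib (f g h : Series K) : (f + g) * h = f * h + g * h := by
  funext w
  simp [Series.mul_apply, Series.add_apply, add_mul, Finset.sum_add_distrib]

protected theorem Series.smul_mul (c : K) (f g : Series K) : c • f * g = c • (f * g) := by
  funext w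
  simp [Series.mul_apply, Series.smul_apply, Finset.mul_sum, mul_assoc]

protected theorem Series.mul_smul (c : K) (f g : Series K) : f * c • g = c • (f * g) := by
  funext w
  simp [Series.mul_apply, Series.smul_apply, Finset.mul_sum, mul_left_comm]

protected theorem Series.mul_assoc (f g h : Series K) : f * g * h = f * (g * h) := by
  funext w
  induction w generalizing f g with
  | nil => simp [Series.mul_nil, mul_assoc]
  | cons a w ih =>
    rw [Series.mul_cons, Series.mul_cons f, ← ih, Series.mul_nil, Series.mul_cons g]
    have : (f * g).shift a = f.shift a * g + f [] • g.shift a := by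
      funext v
      exact Series.mul_cons f g a v
    rw [this, Series.right_distrib, Series.smul_mul, Series.add_apply, Series.smul_apply]
    ring

protected theorem Series.one_mul (f : Series K) : 1 * f = f := by
  funext w
  cases w with
  | nil => simp [Series.mul_nil, Series.one_apply]
  | cons a w =>
    rw [Series.mul_cons]
    simp [Series.mul_apply, Series.one_apply, Series.shift]

protected theorem Series.mul_one (f : Series K) : f * 1 = f := by
  funext w
  induction w generalizing f with
  | nil => simp [Series.mul_nil, Series.one_apply]
  | cons a w ih =>
    rw [Series.mul_cons, ih]
    simp [Series.one_apply, Series.shift]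

noncomputable instance : Ring (Series K) :=
  { (inferInstance : AddCommGroup (Series K)) with
    mul := (· * ·)
    one := 1
    left_distrib := Series.left_distrib
    right_distrib := Series.right_distrib
    zero_mul := fun f => by funext w; simp [Series.mul_apply, Series.zero_apply]
    mul_zero := fun f => by funext w; simp [Series.mul_apply, Series.zero_apply]
    mul_assoc := Series.mul_assoc
    one_mul := Series.one_mul
    mul_one := Series.mul_one }

noncomputable instance : Algebra K (Series K) :=
  Algebra.ofModule Series.smul_mul (fun c f g => Series.mul_smul c f g)

/-- A series restricts to a noncommutative polynomial on every finite subalphabet. -/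
def IsLocallyFinite (f : Series K) : Prop :=
  ∀ B : Finset ℕ+, {w : Word | (∀ a ∈ w, a ∈ B) ∧ f w ≠ 0}.Finite

theorem IsLocallyFinite.splitProd {f g : Series K} (hf : IsLocallyFinite f)
    (hg : IsLocallyFinite g) (P : Word → Word → Prop) : IsLocallyFinite (splitProd P f g) := by
  intro B
  refine (Set.Finite.image2 (· ++ ·) (hf B) (hg B)).subset ?_
  rintro w ⟨hw, hne⟩
  obtain ⟨k, -, hk⟩ := Finset.exists_ne_zero_of_sum_ne_zero hne
  split_ifs at hk with hP
  · refine ⟨w.take k, ⟨fun a ha => hw a (List.mem_of_mem_take ha), left_ne_zero_of_mul hk⟩,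
      w.drop k, ⟨fun a ha => hw a (List.mem_of_mem_drop ha), right_ne_zero_of_mul hk⟩,
      List.take_append_drop k w⟩
  · exact absurd rfl hk

variable (K)

/-- `K⟨A⟩` for the infinite alphabet `A`: the projective limit of the free algebras `K⟨B⟩` over
the finite `B ⊆ A`, i.e. the series all of whose restrictions to finite subalphabets are
polynomials, with the concatenation product. -/
noncomputable def ncPoly : Subalgebra K (Series K) where
  carrier := {f | IsLocallyFinite f}
  mul_mem' := fun hf hg => IsLocallyFinite.splitProd hf hg _
  add_mem' := fun {f g} hf hg B => ((hf B).union (hg B)).subset <| by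
    rintro w ⟨hw, hne⟩
    by_cases h : f w = 0
    · exact Or.inr ⟨hw, fun h' => hne (by rw [Series.add_apply, h, h', add_zero])⟩
    · exact Or.inl ⟨hw, h⟩
  algebraMap_mem' := fun c B => (Set.finite_singleton ([] : Word)).subset <| by
    rintro w ⟨-, hne⟩
    by_contra h
    apply hne
    rw [Algebra.algebraMap_eq_smul_one, Series.smul_apply, Series.one_apply,
      if_neg (fun h' => h (Set.mem_singleton_iff.2 h')), mul_zero]

/-- The elements of `K⟨A⟩`. -/
abbrev NCPoly : Type _ := ↥(ncPoly K)

/-! ### The dendriform trialgebra operations and `TD` -/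

variable {K}

/-- On nonempty words, `u ≺ v` is `uv` if `max u > max v`, and `0` otherwise. -/
noncomputable def dendLeft (f g : NCPoly K) : NCPoly K :=
  ⟨splitProd (fun u v => u ≠ [] ∧ v ≠ [] ∧ v.maximum < u.maximum) f.1 g.1,
    IsLocallyFinite.splitProd f.2 g.2 _⟩

/-- On nonempty words, `u ∘ v` is `uv` if `max u = max v`, and `0` otherwise. -/
noncomputable def dendMid (f g : NCPoly K) : NCPoly K :=
  ⟨splitProd (fun u v => u ≠ [] ∧ v ≠ [] ∧ u.maximum = v.maximum) f.1 g.1,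
    IsLocallyFinite.splitProd f.2 g.2 _⟩

/-- On nonempty words, `u ≻ v` is `uv` if `max u < max v`, and `0` otherwise. -/
noncomputable def dendRight (f g : NCPoly K) : NCPoly K :=
  ⟨splitProd (fun u v => u ≠ [] ∧ v ≠ [] ∧ u.maximum < v.maximum) f.1 g.1,
    IsLocallyFinite.splitProd f.2 g.2 _⟩

theorem coe_dendLeft (f g : NCPoly K) : (dendLeft f g).1
    = splitProd (fun u v => u ≠ [] ∧ v ≠ [] ∧ v.maximum < u.maximum) f.1 g.1 := rfl

theorem coe_dendMid (f g : NCPoly K) : (dendMid f g).1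
    = splitProd (fun u v => u ≠ [] ∧ v ≠ [] ∧ u.maximum = v.maximum) f.1 g.1 := rfl

theorem coe_dendRight (f g : NCPoly K) : (dendRight f g).1
    = splitProd (fun u v => u ≠ [] ∧ v ≠ [] ∧ u.maximum < v.maximum) f.1 g.1 := rfl

variable (K)

/-- `M_u`, the sum of all words `w` with `pack w = u`. -/
def M (u : Word) : NCPoly K :=
  ⟨fun w => if pack w = u then 1 else 0, fun B => (finite_words B u.length).subset <| by
    rintro w ⟨hw, hne⟩
    refine ⟨hw, ?_⟩
    by_contra h
    refine hne (if_neg fun h' => h ?_)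
    rw [← h', length_pack]⟩

variable {K}

/-- A sub-trialgebra of `K⟨A⟩⁺`: a subspace of the augmentation ideal `K⟨A⟩⁺` (series without
constant term) that is stable under the three dendriform operations. -/
structure IsSubTrialgebra (V : Submodule K (NCPoly K)) : Prop where
  aug : ∀ f ∈ V, f.1 [] = 0
  left : ∀ f ∈ V, ∀ g ∈ V, dendLeft f g ∈ V
  mid : ∀ f ∈ V, ∀ g ∈ V, dendMid f g ∈ V
  right : ∀ f ∈ V, ∀ g ∈ V, dendRight f g ∈ V

/-- On `K⟨A⟩⁺` the product is the sum of the three dendriform operations. -/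
theorem mul_eq_dend (f g : NCPoly K) (hf : f.1 [] = 0) (hg : g.1 [] = 0) :
    f * g = dendLeft f g + dendMid f g + dendRight f g := by
  apply Subtype.ext
  funext w
  change (f.1 * g.1) w = (dendLeft f g).1 w + (dendMid f g).1 w + (dendRight f g).1 w
  rw [Series.mul_apply, coe_dendLeft, coe_dendMid, coe_dendRight]
  simp only [splitProd, ← Finset.sum_add_distrib]
  refine Finset.sum_congr rfl fun k _ => ?_
  by_cases hu : w.take k = []
  · simp [hu, hf]
  by_cases hv : w.drop k = []
  · simp [hv, hg]
  rcases lt_trichotomy (w.take k).maximum (w.drop k).maximum with h | h | h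
  · simp [hu, hv, h, h.ne, h.not_gt]
  · simp [hu, hv, h]
  · simp [hu, hv, h, h.ne', h.not_gt]

/-- The augmentation ideal `K⟨A⟩⁺`. -/
def aug : Submodule K (NCPoly K) where
  carrier := {f | f.1 [] = 0}
  add_mem' := fun {f g} hf hg => by
    change f.1 [] + g.1 [] = 0
    rw [show f.1 [] = 0 from hf, show g.1 [] = 0 from hg, add_zero]
  zero_mem' := rfl
  smul_mem' := fun c f hf => by
    change c * f.1 [] = 0
    rw [show f.1 [] = 0 from hf, mul_zero]

theorem isSubTrialgebra_aug : IsSubTrialgebra (aug : Submodule K (NCPoly K)) where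
  aug := fun _ hf => hf
  left := fun f _ g _ => by
    change (dendLeft f g).1 [] = 0
    simp [coe_dendLeft, splitProd]
  mid := fun f _ g _ => by
    change (dendMid f g).1 [] = 0
    simp [coe_dendMid, splitProd]
  right := fun f _ g _ => by
    change (dendRight f g).1 [] = 0
    simp [coe_dendRight, splitProd]

theorem M_one_mem_aug : M K [1] ∈ (aug : Submodule K (NCPoly K)) := by
  change (if pack [] = [1] then (1 : K) else 0) = 0
  simp [pack]

variable (K)

/-- `TD`: the sub-trialgebra generated by `M_1`, the sum of all letters. It is a (nonunital)
subalgebra of `K⟨A⟩`. -/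
noncomputable def TD : NonUnitalSubalgebra K (NCPoly K) :=
  { sInf {V : Submodule K (NCPoly K) | IsSubTrialgebra V ∧ M K [1] ∈ V} with
    mul_mem' := fun {f g} hf hg => by
      have hf' := Submodule.mem_sInf.1 hf
      have hg' := Submodule.mem_sInf.1 hg
      refine Submodule.mem_sInf.2 fun V hV => ?_
      rw [mul_eq_dend f g (hV.1.aug f (hf' V hV)) (hV.1.aug g (hg' V hV))]
      exact V.add_mem (V.add_mem (hV.1.left f (hf' V hV) g (hg' V hV))
        (hV.1.mid f (hf' V hV) g (hg' V hV))) (hV.1.right f (hf' V hV) g (hg' V hV)) }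

end Series

/-! ### Segmented compositions -/

/-- The separators of a segmented composition. -/
inductive Sep
  | comma
  | bar

/-- A segmented composition (of an integer `n ≥ 1`): a nonempty finite sequence of positive
integers separated by commas or bars. It is given by its first part and the list of the later
parts, each with the separator in front of it: `(2,1|2)` is `⟨2, [(comma, 1), (bar, 2)]⟩`. -/
@[ext]
structure SegComp where
  head : ℕ+
  tail : List (Sep × ℕ+)

namespace SegComp

/-- The segmented composition `(1)`. -/
def one : SegComp := ⟨1, []⟩

/-- `I,J` and `I|J`: concatenation with the separator `s` in between. -/
def concat (s : Sep) (I J : SegComp) : SegComp := ⟨I.head, I.tail ++ (s, J.head) :: J.tail⟩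

/-- Auxiliary form of `glue`, by recursion on the parts after the first one. -/
def glueAux (p : ℕ+) : List (Sep × ℕ+) → SegComp → SegComp
  | [], J => ⟨p + J.head, J.tail⟩
  | (s, q) :: t, J => ⟨p, (s, (glueAux q t J).head) :: (glueAux q t J).tail⟩

/-- `I ▷ J`: the last part of `I` and the first part of `J` are glued into one part, their sum. -/
def glue (I J : SegComp) : SegComp := glueAux I.head I.tail J

/-- The comparison sign that encodes a separator: `=` for a comma, `>` for a bar. -/
def sepSign : Sep → Ordering
  | .comma => .eq
  | .bar => .gt

/-- The sequence of `n - 1` signs of a segmented composition of `n`: inside each part the signs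
are `<`, a comma gives `=` and a bar gives `>`. -/
def signs (I : SegComp) : List Ordering :=
  List.replicate ((I.head : ℕ) - 1) .lt ++
    I.tail.flatMap fun x => sepSign x.1 :: List.replicate ((x.2 : ℕ) - 1) .lt

/-- The segmented composition with a given sequence of signs. -/
def ofSigns : List Ordering → SegComp
  | [] => one
  | .lt :: s => ⟨(ofSigns s).head + 1, (ofSigns s).tail⟩
  | .eq :: s => ⟨1, (.comma, (ofSigns s).head) :: (ofSigns s).tail⟩
  | .gt :: s => ⟨1, (.bar, (ofSigns s).head) :: (ofSigns s).tail⟩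

theorem signs_ofSigns (s : List Ordering) : (ofSigns s).signs = s := by
  induction s with
  | nil => rfl
  | cons a s ih =>
    cases a
    · have h : ((ofSigns s).head : ℕ) + 1 - 1 = ((ofSigns s).head : ℕ) - 1 + 1 := by
        have := (ofSigns s).head.pos
        omega
      conv_rhs => rw [← ih]
      simp only [ofSigns, signs, PNat.add_coe, PNat.one_coe, h, List.replicate_succ,
        List.cons_append]
    all_goals
      conv_rhs => rw [← ih]
      simp [ofSigns, signs, sepSign]

theorem ofSigns_replicate_append (k : ℕ) (s : List Ordering) :
    ((ofSigns (List.replicate k .lt ++ s)).head : ℕ) = k + (ofSigns s).head ∧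
      (ofSigns (List.replicate k .lt ++ s)).tail = (ofSigns s).tail := by
  induction k with
  | zero => simp
  | succ k ih =>
    simp only [List.replicate_succ, List.cons_append, ofSigns, PNat.add_coe, PNat.one_coe, ih.1,
      ih.2, and_true]
    omega

theorem ofSigns_signs (I : SegComp) : ofSigns I.signs = I := by
  obtain ⟨p, t⟩ := I
  induction t generalizing p with
  | nil =>
    have h := ofSigns_replicate_append ((p : ℕ) - 1) []
    have hp := p.pos
    refine SegComp.ext (PNat.eq ?_) ?_
    · refine h.1.trans ?_
      simp only [ofSigns, one, PNat.one_coe]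
      omega
    · exact h.2
  | cons x t ih =>
    obtain ⟨s, q⟩ := x
    have h := ofSigns_replicate_append ((p : ℕ) - 1) (sepSign s :: signs ⟨q, t⟩)
    have hp := p.pos
    have hs : ofSigns (sepSign s :: signs ⟨q, t⟩) = ⟨1, (s, q) :: t⟩ := by
      cases s <;> simp [sepSign, ofSigns, ih q]
    rw [hs] at h
    refine SegComp.ext (PNat.eq ?_) ?_
    · refine h.1.trans ?_
      simp only [PNat.one_coe]
      omega
    · exact h.2

/-- The bijection between segmented compositions and sequences of signs. -/
def signEquiv : SegComp ≃ List Ordering := ⟨signs, ofSigns, ofSigns_signs, signs_ofSigns⟩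

end SegComp

/-- The sequence of comparison signs between consecutive letters of a word. -/
def compSigns : Word → List Ordering
  | a :: b :: w => compare a b :: compSigns (b :: w)
  | _ => []

/-- The segmented composition `SC(w)` of a nonempty word `w` (`(1)` on the empty word, which is
excluded wherever this is used). -/
def SC (w : Word) : SegComp := SegComp.signEquiv.symm (compSigns w)

theorem length_compSigns (w : Word) : (compSigns w).length = w.length - 1 := by
  induction w with
  | nil => rfl
  | cons a w ih => cases w with
    | nil => rfl
    | cons b w => simp [compSigns, ih]

theorem finite_packed_SC (I : SegComp) : {u : Word | u ≠ [] ∧ IsPacked u ∧ SC u = I}.Finite := by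
  refine (finite_words (Finset.Icc 1 I.signs.length.succPNat)
    (I.signs.length + 1)).subset ?_
  rintro u ⟨hne, hu, rfl⟩
  have h : (SC u).signs = compSigns u := SegComp.signs_ofSigns _
  have hl : u.length = (SC u).signs.length + 1 := by
    have := List.length_pos_iff.2 hne
    rw [h, length_compSigns]
    omega
  refine ⟨fun a ha => Finset.mem_Icc.2 ⟨one_le, ?_⟩, hl⟩
  have := le_length_of_isPacked hu ha
  rw [← PNat.coe_le_coe]
  simpa [← hl] using this

/-! ### The elements `MC_I` and the algebra `TC` -/

section TC

variable (K : Type*) [CommRing K]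

/-- `MC_I`, the sum of `M_u` over the (finitely many) nonempty packed words `u` with
`SC(u) = I`. -/
noncomputable def MC (I : SegComp) : NCPoly K := ∑ u ∈ (finite_packed_SC I).toFinset, M K u

/-- `TC`: the subalgebra generated by the `MC_I`. -/
noncomputable def TC : NonUnitalSubalgebra K (NCPoly K) :=
  NonUnitalAlgebra.adjoin K (Set.range (MC K))

/-- `MC_I` as an element of `TC`. -/
noncomputable def mc (I : SegComp) : ↥(TC K) :=
  ⟨MC K I, NonUnitalAlgebra.subset_adjoin K (Set.mem_range_self I)⟩

end TC

/-! ### Cubical trialgebras -/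

/-- The names of the three operations of a cubical trialgebra. -/
inductive CubOp
  | left
  | mid
  | right

/-- A cubical trialgebra: a vector space with three bilinear operations `⊣`, `⊥`, `⊢` such that
`(x ∘₁ y) ∘₂ z = x ∘₁ (y ∘₂ z)` for all nine choices of `∘₁, ∘₂ ∈ {⊣, ⊥, ⊢}`. -/
structure CubicalTrialgebra (K : Type*) [CommRing K] (V : Type*) [AddCommGroup V]
    [Module K V] where
  op : CubOp → V →ₗ[K] V →ₗ[K] V
  assoc : ∀ (i j : CubOp) (x y z : V), op j (op i x y) z = op i x (op j y z)

/-- `V` is the free cubical trialgebra on the generator `e`: for every cubical trialgebra `W` and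
every `b : W` there is exactly one morphism of cubical trialgebras `V → W` with `e ↦ b`. -/
def CubicalTrialgebra.IsFreeOn {K : Type u} [CommRing K] {V : Type v} [AddCommGroup V]
    [Module K V] (T : CubicalTrialgebra K V) (e : V) : Prop :=
  ∀ (W : Type w) [AddCommGroup W] [Module K W] (S : CubicalTrialgebra K W) (b : W),
    ∃! φ : V →ₗ[K] W, (∀ i x y, φ (T.op i x y) = S.op i (φ x) (φ y)) ∧ φ e = b

end WQ

namespace WQ

/-! ### Signs of words and of segmented compositions -/

/-! Packing relabels letters by a strictly increasing map, so it preserves comparison signs. Hence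
`MC_I` is the sum of all nonempty words whose sign sequence is that of `I` (`MC_eq_signInd`), and
everything can be read off sign sequences. In a product of two such sums each word is cut at a fixed
place, and the only freedom is the sign at the cut; its three values give the product rule
(`MC_mul_MC`). Different `MC_I` have disjoint supports, nonempty since every sign sequence is
realized, whence linear independence.

Membership in `TD` is the less formal part, because the dendriform operations compare maxima and not
the letters at the cut. Three sums with prescribed signs are treated together, by induction on the
number of signs: over words whose head is a strict maximum, over words whose head is a weak maximum,
and over all words. A strict-head word of length at least 2 is a letter `≺` a word; a weak-head word
with a repeated maximum, cut before the second maximum, is strict-head `∘` weak-head; any other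
word, cut before its first maximum, is a word `≻` a weak-head word. The head condition on the right
factor makes the maxima determine the sign at the cut in the last two cases; `≺` with a single
letter on the left does so in the first.

For freeness, the three operations join two sign sequences with a sign in between. This is
associative for every pair of signs, and the nine relations allow any expression in one generator to
be rewritten in right-nested form, that is, as a sign sequence. -/

theorem compSigns_map {f : ℕ+ → ℕ+} {w : Word} (hf : StrictMonoOn f {a | a ∈ w}) :
    compSigns (w.map f) = compSigns w := by
  induction w with
  | nil => rfl
  | cons a w ih =>
    cases w with
    | nil => rfl
    | cons b w =>
      have hab : compare (f a) (f b) = compare a b := by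
        have h1 := hf.lt_iff_lt (a := a) (b := b) (by simp) (by simp)
        have h2 := hf.lt_iff_lt (a := b) (b := a) (by simp) (by simp)
        rcases lt_trichotomy a b with h | rfl | h
        · rw [compare_lt_iff_lt.2 h, compare_lt_iff_lt.2 (h1.2 h)]
        · simp
        · rw [compare_gt_iff_gt.2 h, compare_gt_iff_gt.2 (h2.2 h)]
      have := ih (hf.mono fun x hx => List.mem_cons_of_mem _ hx)
      simp only [List.map_cons, compSigns] at this ⊢
      rw [hab, this]

/-- If `a < b` are letters of `w`, then `a` is counted below `b` but not below itself. -/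
theorem strictMonoOn_packing (w : Word) :
    StrictMonoOn (fun b => Nat.succPNat (w.toFinset.filter (· < b)).card) {a | a ∈ w} := by
  intro a ha b _ hab
  rw [Nat.succPNat_lt_succPNat]
  refine Finset.card_lt_card (Finset.ssubset_iff_of_subset ?_ |>.2 ⟨a, ?_, ?_⟩)
  · intro x hx
    rw [Finset.mem_filter] at hx ⊢
    exact ⟨hx.1, hx.2.trans hab⟩
  · simpa using ⟨ha, hab⟩
  · simp

theorem compSigns_pack (w : Word) : compSigns (pack w) = compSigns w :=
  compSigns_map (strictMonoOn_packing w)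

/-- `f` carries the letters below `b` bijectively to those below `f b`, so the counts agree. Applied
to the packing map itself this gives idempotence of `pack`. -/
theorem pack_map {f : ℕ+ → ℕ+} {w : Word} (hf : StrictMonoOn f {a | a ∈ w}) :
    pack (w.map f) = pack w := by
  unfold pack
  rw [List.map_map]
  refine List.map_congr_left fun b hb => ?_
  have : (w.map f).toFinset.filter (· < f b) = (w.toFinset.filter (· < b)).image f := by
    ext x
    simp only [Finset.mem_filter, List.mem_toFinset, List.mem_map, Finset.mem_image]
    constructor
    · rintro ⟨⟨a, ha, rfl⟩, h⟩
      exact ⟨a, ⟨ha, (hf.lt_iff_lt ha hb).1 h⟩, rfl⟩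
    · rintro ⟨a, ⟨ha, h⟩, rfl⟩
      exact ⟨⟨a, ha, rfl⟩, hf ha hb h⟩
  rw [Function.comp_apply, this, Finset.card_image_of_injOn]
  exact hf.injOn.mono fun x hx => by simpa using (Finset.mem_filter.1 hx).1

theorem isPacked_pack (w : Word) : IsPacked (pack w) :=
  pack_map (strictMonoOn_packing w)

theorem pack_eq_nil_iff {w : Word} : pack w = [] ↔ w = [] := by simp [pack]

theorem compSigns_append {u v : Word} (hu : u ≠ []) (hv : v ≠ []) :
    compSigns (u ++ v) = compSigns u ++ compare (u.getLast hu) (v.head hv) :: compSigns v := by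
  induction u with
  | nil => exact absurd rfl hu
  | cons a u ih =>
    cases u with
    | nil =>
      obtain ⟨b, v, rfl⟩ := List.exists_cons_of_ne_nil hv
      rfl
    | cons b u => simpa [compSigns] using ih (by simp)

theorem length_of_compSigns_eq {w : Word} {s : List Ordering} (hw : w ≠ [])
    (h : compSigns w = s) : w.length = s.length + 1 := by
  have := List.length_pos_iff.2 hw
  rw [← h, length_compSigns]
  omega

/-- The length of `u` puts the sign at the cut exactly at the place of `c`, so the three pieces can
be compared separately. -/
theorem compSigns_append_eq_iff {u v : Word} (hu : u ≠ []) (hv : v ≠ []) {s t : List Ordering}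
    {c : Ordering} (hl : u.length = s.length + 1) :
    compSigns (u ++ v) = s ++ c :: t ↔
      compare (u.getLast hu) (v.head hv) = c ∧ compSigns u = s ∧ compSigns v = t := by
  rw [compSigns_append hu hv]
  constructor
  · intro h
    obtain ⟨h1, h2⟩ := List.append_inj h (by rw [length_compSigns, hl]; rfl)
    rw [List.cons.injEq] at h2
    exact ⟨h2.1, h1, h2.2⟩
  · rintro ⟨rfl, rfl, rfl⟩
    rfl

/-- Every sequence of signs is the sequence of comparison signs of some word. -/
theorem exists_compSigns_eq (s : List Ordering) : ∃ w : Word, w ≠ [] ∧ compSigns w = s := by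
  induction s with
  | nil => exact ⟨[1], by simp, rfl⟩
  | cons c s ih =>
    obtain ⟨w, hw, rfl⟩ := ih
    -- Raising all letters by 1 keeps the signs and makes room below: the new first letters `1`, `b
    -- + 1`, `b + 1 + 1` then produce `<`, `=`, `>`.
    have hm : StrictMonoOn (· + (1 : ℕ+)) {a | a ∈ w} := fun a _ b _ h => add_lt_add_left h 1
    have hs := compSigns_map hm
    obtain ⟨b, v, rfl⟩ := List.exists_cons_of_ne_nil hw
    have key : ∀ a, compare a (b + 1) = c →
        compSigns (a :: (b :: v).map (· + 1)) = c :: compSigns (b :: v) := by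
      intro a ha
      rw [← hs, ← ha]
      rfl
    cases c
    · exact ⟨_, by simp, key 1 (compare_lt_iff_lt.2 (PNat.lt_add_left 1 b))⟩
    · exact ⟨_, by simp, key (b + 1) (by simp)⟩
    · exact ⟨_, by simp, key (b + 1 + 1) (compare_gt_iff_gt.2 (PNat.lt_add_right _ _))⟩

namespace SegComp

theorem signs_concat (s : Sep) (I J : SegComp) :
    (concat s I J).signs = I.signs ++ sepSign s :: J.signs := by
  simp [concat, signs]

theorem signs_glue (I J : SegComp) : (I.glue J).signs = I.signs ++ .lt :: J.signs := by
  obtain ⟨p, t⟩ := I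
  induction t generalizing p with
  | nil =>
    have h : (p : ℕ) + J.head - 1 = (p - 1) + (J.head - 1 + 1) := by
      have := p.pos
      have := J.head.pos
      omega
    simp [glue, glueAux, signs, h, List.replicate_add, List.replicate_succ]
  | cons x t ih =>
    have := ih x.2
    simp only [glue, signs] at this
    simp [glue, glueAux, signs, this]

end SegComp

/-! ### Indicator series of sets of words with given signs -/

section Indicator

variable (K : Type*) [CommRing K]

open Classical in
/-- The sum of all nonempty words `w` with `P w` whose sequence of comparison signs is `s`. -/
noncomputable def signInd (s : List Ordering) (P : Word → Prop) : NCPoly K :=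
  ⟨fun w => if w ≠ [] ∧ compSigns w = s ∧ P w then 1 else 0,
    fun B => (finite_words B (s.length + 1)).subset <| by
      rintro w ⟨hw, hne⟩
      refine ⟨hw, ?_⟩
      by_contra h
      exact hne (if_neg fun h' => h (length_of_compSigns_eq h'.1 h'.2.1))⟩

open Classical in
theorem signInd_apply (s : List Ordering) (P : Word → Prop) (w : Word) :
    (signInd K s P).1 w = if w ≠ [] ∧ compSigns w = s ∧ P w then 1 else 0 := rfl

theorem signInd_true_apply (s : List Ordering) (w : Word) :
    (signInd K s fun _ => True).1 w = if w ≠ [] ∧ compSigns w = s then 1 else 0 := by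
  simp [signInd_apply]

variable {K}

theorem signInd_congr {s : List Ordering} {P Q : Word → Prop}
    (h : ∀ w, w ≠ [] → compSigns w = s → (P w ↔ Q w)) : signInd K s P = signInd K s Q := by
  classical
  refine Subtype.ext (funext fun w => ?_)
  rw [signInd_apply, signInd_apply]
  refine if_congr ?_ rfl rfl
  exact and_congr_right fun h1 => and_congr_right fun h2 => h w h1 h2

theorem signInd_eq_zero {s : List Ordering} {P : Word → Prop}
    (h : ∀ w, w ≠ [] → compSigns w = s → ¬ P w) : signInd K s P = 0 := by
  classical
  refine Subtype.ext (funext fun w => ?_)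
  rw [signInd_apply, if_neg fun h' => h w h'.1 h'.2.1 h'.2.2]
  rfl

variable (K) in
/-- The restricted concatenation products of indicator series are indicator series. -/
theorem splitProd_signInd {Q : Word → Word → Prop} {s t : List Ordering} {c : Ordering}
    {P P' R : Word → Prop}
    (h : ∀ u v, u ≠ [] → v ≠ [] → u.length = s.length + 1 →
      (compSigns (u ++ v) = s ++ c :: t ∧ R (u ++ v) ↔
        Q u v ∧ (compSigns u = s ∧ P u) ∧ compSigns v = t ∧ P' v)) :
    splitProd Q (signInd K s P).1 (signInd K t P').1 = (signInd K (s ++ c :: t) R).1 := by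
  classical
  funext w
  have term : ∀ u v : Word, (if Q u v then (signInd K s P).1 u * (signInd K t P').1 v else 0) =
      if Q u v ∧ (u ≠ [] ∧ compSigns u = s ∧ P u) ∧ v ≠ [] ∧ compSigns v = t ∧ P' v
        then 1 else 0 := by
    intro u v
    rw [signInd_apply, signInd_apply, ite_zero_mul_ite_zero, mul_one, ← ite_and]
  unfold splitProd
  simp only [term]
  -- A left factor with signs `s` has length `s.length + 1`, so at most one cut contributes; in any
  -- other total length both sides vanish.
  by_cases hl : w.length = s.length + 1 + (t.length + 1)
  · rw [Finset.sum_eq_single (s.length + 1), signInd_apply]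
    · have hlen : (w.take (s.length + 1)).length = s.length + 1 := by
        rw [List.length_take]
        omega
      have hu : w.take (s.length + 1) ≠ [] := List.length_pos_iff.1 (by omega)
      have hv : w.drop (s.length + 1) ≠ [] := List.length_pos_iff.1 (by
        rw [List.length_drop]
        omega)
      have hw : w ≠ [] := List.length_pos_iff.1 (by omega)
      have := h _ _ hu hv hlen
      rw [List.take_append_drop] at this
      refine if_congr ?_ rfl rfl
      simp only [hu, hv, hw, this, ne_eq, not_false_eq_true, true_and]
    · intro k hk hne
      refine if_neg fun h' => hne ?_
      have := length_of_compSigns_eq h'.2.1.1 h'.2.1.2.1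
      rw [List.length_take] at this
      rw [Finset.mem_range] at hk
      omega
    · intro hk
      rw [Finset.mem_range] at hk
      omega
  · rw [signInd_apply, if_neg, Finset.sum_eq_zero]
    · intro k _
      refine if_neg fun h' => hl ?_
      have h1 := length_of_compSigns_eq h'.2.1.1 h'.2.1.2.1
      have h2 := length_of_compSigns_eq h'.2.2.1 h'.2.2.2.1
      rw [← List.take_append_drop k w, List.length_append, h1, h2]
    · intro h'
      have := length_of_compSigns_eq h'.1 h'.2.1
      rw [List.length_append, List.length_cons] at this
      omega

/-- The only `u` contributing to the coefficient of `w` is `pack w`, which is packed and has the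
same signs as `w`. -/
theorem MC_eq_signInd (I : SegComp) : MC K I = signInd K I.signs fun _ => True := by
  classical
  refine Subtype.ext (funext fun w => ?_)
  have hc : ∀ S : Finset Word, (∑ u ∈ S, M K u).1 w = ∑ u ∈ S, (M K u).1 w := by
    intro S
    induction S using Finset.induction_on with
    | empty => rfl
    | insert a S ha ih =>
      rw [Finset.sum_insert ha, Finset.sum_insert ha, ← ih]
      rfl
  rw [MC, hc, signInd_true_apply]
  change ∑ u ∈ _, (if pack w = u then (1 : K) else 0) = _
  rw [Finset.sum_ite_eq]
  refine if_congr ?_ rfl rfl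
  have hSC : SC (pack w) = I ↔ compSigns w = I.signs := by
    rw [SC, compSigns_pack, Equiv.symm_apply_eq]
    rfl
  simp [isPacked_pack, pack_eq_nil_iff, hSC]

theorem M_one_eq_signInd : M K [1] = signInd K [] fun _ => True := by
  classical
  refine Subtype.ext (funext fun w => ?_)
  rw [signInd_true_apply]
  refine if_congr ?_ rfl rfl
  rcases w with _ | ⟨a, _ | ⟨b, w⟩⟩
  · simp [pack]
  · have : pack [a] = [1] := by
      simp only [pack, List.map_cons, List.map_nil, List.cons.injEq, and_true]
      rw [Finset.filter_false_of_mem (by simp)]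
      rfl
    simp [this, compSigns]
  · simp [pack, compSigns]

theorem MC_mul_MC (I J : SegComp) : MC K I * MC K J =
    MC K (I.glue J) + MC K (.concat .comma I J) + MC K (.concat .bar I J) := by
  -- Splits the product by the sign at the cut. Cuts with an empty factor have no such sign, but
  -- they contribute 0 as `MC_I` has no constant term.
  let Q : Ordering → Word → Word → Prop := fun c u v =>
    ∃ (hu : u ≠ []) (hv : v ≠ []), compare (u.getLast hu) (v.head hv) = c
  have key : ∀ c, splitProd (Q c) (MC K I).1 (MC K J).1 =
      (signInd K (I.signs ++ c :: J.signs) fun _ => True).1 := by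
    intro c
    rw [MC_eq_signInd, MC_eq_signInd]
    refine splitProd_signInd K fun u v hu hv hl => ?_
    rw [compSigns_append_eq_iff hu hv hl]
    simp [Q, hu, hv]
  rw [MC_eq_signInd (I.glue J), MC_eq_signInd (.concat .comma I J),
    MC_eq_signInd (.concat .bar I J), SegComp.signs_glue, SegComp.signs_concat,
    SegComp.signs_concat]
  refine Subtype.ext (funext fun w => ?_)
  change ((MC K I).1 * (MC K J).1) w = (signInd K (I.signs ++ .lt :: J.signs) fun _ => True).1 w +
    (signInd K (I.signs ++ .eq :: J.signs) fun _ => True).1 w +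
    (signInd K (I.signs ++ .gt :: J.signs) fun _ => True).1 w
  rw [Series.mul_apply, ← key, ← key, ← key]
  simp only [splitProd, ← Finset.sum_add_distrib]
  refine Finset.sum_congr rfl fun k _ => ?_
  have hnil : ∀ I : SegComp, (MC K I).1 [] = 0 := fun I => by
    rw [MC_eq_signInd, signInd_apply, if_neg (by simp)]
  generalize w.take k = x, w.drop k = y
  by_cases hu : x = []
  · simp [hu, hnil]
  by_cases hv : y = []
  · simp [hv, hnil]
  rcases hc : compare (x.getLast hu) (y.head hv) with _ | _ | _ <;>
    simp only [Q, hu, hv, hc, ne_eq, not_false_eq_true, exists_true_left] <;> simp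

/-- The coefficient at a word with the signs of `I` is 1 on `MC_I` and 0 on every other `MC_J`. -/
theorem linearIndependent_MC : LinearIndependent K (MC K) := by
  classical
  rw [linearIndependent_iff']
  intro S g hg I hI
  obtain ⟨w, hw, hs⟩ := exists_compSigns_eq I.signs
  let ev : NCPoly K →ₗ[K] K :=
    { toFun := fun f => f.1 w
      map_add' := fun _ _ => rfl
      map_smul' := fun _ _ => rfl }
  have hev : ∀ J, ev (MC K J) = if I = J then 1 else 0 := by
    intro J
    change (MC K J).1 w = _
    rw [MC_eq_signInd, signInd_true_apply, hs]
    refine if_congr ?_ rfl rfl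
    simp only [ne_eq, hw, not_false_eq_true, true_and]
    exact SegComp.signEquiv.injective.eq_iff
  have := congrArg ev hg
  rw [map_sum, map_zero] at this
  simpa [hev, hI] using this

end Indicator

/-! ### The `MC_I` belong to `TD` -/

/-- The first letter of the word is strictly larger than the others. -/
def StrictHead (w : Word) : Prop := ∃ m v, w = m :: v ∧ ∀ a ∈ v, a < m

/-- The first letter of the word is a maximum. -/
def WeakHead (w : Word) : Prop := ∃ m v, w = m :: v ∧ ∀ a ∈ v, a ≤ m

theorem strictHead_cons {m : ℕ+} {v : Word} : StrictHead (m :: v) ↔ ∀ a ∈ v, a < m := by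
  simp [StrictHead]

theorem weakHead_cons {m : ℕ+} {v : Word} : WeakHead (m :: v) ↔ ∀ a ∈ v, a ≤ m := by
  simp [WeakHead]

/-! ### Cutting words at occurrences of the maximum -/

theorem maximum_cons_eq_iff {m : ℕ+} {v : Word} :
    List.maximum (m :: v) = m ↔ ∀ a ∈ v, a ≤ m := by
  simp [List.maximum_eq_coe_iff]

theorem maximum_lt_coe_iff {m : ℕ+} {v : Word} : v.maximum < m ↔ ∀ a ∈ v, a < m := by
  induction v with
  | nil => simp
  | cons a v ih => simp [List.maximum_cons, ih]

/-- The position after the first letter at which the first letter occurs again (the length of the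
word if it does not). -/
def secondIdx : Word → ℕ
  | [] => 0
  | m :: v => v.idxOf m + 1

/-- The position of the first occurrence of the maximal letter. -/
def maxIdx (w : Word) : ℕ := w.findIdx fun a : ℕ+ => decide (w.maximum = (a : WithBot ℕ+))

theorem secondIdx_le_length (w : Word) : secondIdx w ≤ w.length := by
  cases w with
  | nil => simp [secondIdx]
  | cons m v => simpa [secondIdx] using List.idxOf_le_length

theorem secondIdx_append_eq_length_iff {m a : ℕ+} {u v : Word} :
    secondIdx ((m :: u) ++ a :: v) = (m :: u).length ↔ m ∉ u ∧ m = a := by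
  simp only [List.cons_append, secondIdx, List.length_cons, Nat.add_right_cancel_iff,
    List.idxOf_append]
  split_ifs with h
  · have := List.idxOf_lt_length_of_mem h
    simp [h, this.ne]
  · rcases eq_or_ne m a with rfl | ha
    · simp [h]
    · simp [h, List.idxOf_cons_ne _ ha.symm, ha]

theorem weakHead_secondIdx_eq_length_iff {w : Word} (hw : w ≠ []) :
    WeakHead w ∧ secondIdx w = w.length ↔ StrictHead w := by
  obtain ⟨m, v, rfl⟩ := List.exists_cons_of_ne_nil hw
  simp only [weakHead_cons, strictHead_cons, secondIdx, List.length_cons,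
    Nat.add_right_cancel_iff, List.idxOf_eq_length_iff]
  constructor
  · rintro ⟨h1, h2⟩ a ha
    exact (h1 a ha).lt_of_ne fun h => h2 (h ▸ ha)
  · intro h
    exact ⟨fun a ha => (h a ha).le, fun hm => lt_irrefl _ (h m hm)⟩

theorem maxIdx_lt_length {w : Word} (hw : w ≠ []) : maxIdx w < w.length := by
  rw [maxIdx, List.findIdx_lt_length]
  obtain ⟨m, hm⟩ := WithBot.ne_bot_iff_exists.1 (List.maximum_ne_bot_of_ne_nil hw)
  exact ⟨m, List.maximum_mem hm.symm, by simpa using hm.symm⟩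

/-- The inequality is strict on the left and weak on the right because the first occurrence of the
maximum is located. -/
theorem maxIdx_append_eq_length_iff {u v : Word} {m : ℕ+} :
    maxIdx (u ++ m :: v) = u.length ↔ (∀ a ∈ u, a < m) ∧ ∀ a ∈ v, a ≤ m := by
  have hmax : (u ++ m :: v).maximum = m ↔ (∀ a ∈ u, a ≤ m) ∧ ∀ a ∈ v, a ≤ m := by
    simp only [List.maximum_eq_coe_iff, List.mem_append, List.mem_cons]
    constructor
    · exact fun h => ⟨fun a ha => h.2 a (.inl ha), fun a ha => h.2 a (.inr (.inr ha))⟩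
    · rintro ⟨h1, h2⟩
      refine ⟨by simp, ?_⟩
      rintro a (ha | rfl | ha)
      exacts [h1 a ha, le_rfl, h2 a ha]
  unfold maxIdx
  rw [List.findIdx_append]
  split_ifs with h
  · refine iff_of_false h.ne fun h' => ?_
    obtain ⟨a, ha, hp⟩ := List.findIdx_lt_length.1 h
    rw [hmax.2 ⟨fun a ha => (h'.1 a ha).le, h'.2⟩, decide_eq_true_eq, WithBot.coe_inj] at hp
    exact lt_irrefl _ (hp ▸ h'.1 a ha)
  · rw [List.findIdx_lt_length] at h
    push Not at h
    rw [List.findIdx_cons]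
    by_cases hm : (u ++ m :: v).maximum = m
    · have h' := hmax.1 hm
      simp only [hm, decide_true, cond_true, zero_add, true_iff]
      refine ⟨fun a ha => (h'.1 a ha).lt_of_ne ?_, h'.2⟩
      rintro rfl
      exact h a ha (by simpa using hm)
    · refine iff_of_false ?_ fun h' => hm (hmax.2 ⟨fun a ha => (h'.1 a ha).le, h'.2⟩)
      simp [hm]

theorem maxIdx_eq_zero_iff {w : Word} (hw : w ≠ []) : maxIdx w = 0 ↔ WeakHead w := by
  obtain ⟨m, v, rfl⟩ := List.exists_cons_of_ne_nil hw
  simpa [weakHead_cons] using maxIdx_append_eq_length_iff (u := []) (m := m) (v := v)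

/-- The words `u v` in which `u` is an initial segment up to the second occurrence of the
maximum, which is the first letter. -/
theorem weakHead_secondIdx_append_iff {u v : Word} (hu : u ≠ []) (hv : v ≠ []) :
    WeakHead (u ++ v) ∧ secondIdx (u ++ v) = u.length ↔
      u.maximum = v.maximum ∧ StrictHead u ∧ WeakHead v := by
  obtain ⟨m, u, rfl⟩ := List.exists_cons_of_ne_nil hu
  obtain ⟨a, v, rfl⟩ := List.exists_cons_of_ne_nil hv
  rw [secondIdx_append_eq_length_iff, List.cons_append, weakHead_cons, strictHead_cons,
    weakHead_cons]
  constructor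
  · rintro ⟨h, hm, rfl⟩
    have h1 : ∀ b ∈ u, b ≤ m := fun b hb => h b (by simp [hb])
    have h2 : ∀ b ∈ v, b ≤ m := fun b hb => h b (by simp [hb])
    refine ⟨?_, fun b hb => (h1 b hb).lt_of_ne fun e => hm (e ▸ hb), h2⟩
    rw [maximum_cons_eq_iff.2 h1, maximum_cons_eq_iff.2 h2]
  · rintro ⟨h, h1, h2⟩
    rw [maximum_cons_eq_iff.2 fun b hb => (h1 b hb).le, maximum_cons_eq_iff.2 h2,
      WithBot.coe_inj] at h
    subst h
    refine ⟨fun b hb => ?_, fun hm => lt_irrefl _ (h1 m hm), rfl⟩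
    rw [List.mem_append, List.mem_cons] at hb
    rcases hb with hb | rfl | hb
    exacts [(h1 b hb).le, le_rfl, h2 b hb]

/-- The words `u v` in which `v` starts at the first occurrence of the maximum. -/
theorem maxIdx_append_iff {u v : Word} (hv : v ≠ []) :
    maxIdx (u ++ v) = u.length ↔ u.maximum < v.maximum ∧ WeakHead v := by
  obtain ⟨m, v, rfl⟩ := List.exists_cons_of_ne_nil hv
  rw [maxIdx_append_eq_length_iff, weakHead_cons]
  refine and_congr_left fun h => ?_
  rw [maximum_cons_eq_iff.2 h, maximum_lt_coe_iff]

/-- `v` starts with the common maximum, and the last letter of `u` attains it only when it is also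
the head of `u`. So at a `∘`-cut the sign is forced by the length of `u`. -/
theorem compare_of_maximum_eq {u v : Word} (hu : u ≠ []) (hv : v ≠ [])
    (h : u.maximum = v.maximum) (h1 : StrictHead u) (h2 : WeakHead v) :
    compare (u.getLast hu) (v.head hv) = if u.length = 1 then .eq else .lt := by
  obtain ⟨m, u, rfl⟩ := List.exists_cons_of_ne_nil hu
  obtain ⟨a, v, rfl⟩ := List.exists_cons_of_ne_nil hv
  rw [strictHead_cons] at h1
  rw [maximum_cons_eq_iff.2 fun b hb => (h1 b hb).le,
    maximum_cons_eq_iff.2 (weakHead_cons.1 h2), WithBot.coe_inj] at h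
  subst h
  by_cases hn : u = []
  · simp [hn]
  · rw [if_neg (by simpa using hn), List.getLast_cons hn]
    exact compare_lt_iff_lt.2 (h1 _ (List.getLast_mem hn))

theorem compare_of_maximum_lt {u v : Word} (hu : u ≠ []) (hv : v ≠ [])
    (h : u.maximum < v.maximum) (h2 : WeakHead v) :
    compare (u.getLast hu) (v.head hv) = .lt := by
  obtain ⟨a, v, rfl⟩ := List.exists_cons_of_ne_nil hv
  rw [maximum_cons_eq_iff.2 (weakHead_cons.1 h2), maximum_lt_coe_iff] at h
  exact compare_lt_iff_lt.2 (h _ (List.getLast_mem hu))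

/-! ### Indicator series inside a sub-trialgebra containing `M_1` -/

section TD

variable {K : Type*} [CommRing K]

/-- An indicator series is the sum of its parts on which a bounded statistic is constant. -/
theorem signInd_eq_sum {s : List Ordering} {P : Word → Prop} {f : Word → ℕ} {n : ℕ}
    (hf : ∀ w, w ≠ [] → compSigns w = s → P w → f w < n) :
    signInd K s P = ∑ k ∈ Finset.range n, signInd K s fun w => P w ∧ f w = k := by
  classical
  refine Subtype.ext (funext fun w => ?_)
  have hc : ∀ S : Finset ℕ, (∑ k ∈ S, signInd K s fun w => P w ∧ f w = k).1 w =
      ∑ k ∈ S, (signInd K s fun w => P w ∧ f w = k).1 w := by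
    intro S
    induction S using Finset.induction_on with
    | empty => rfl
    | insert a S ha ih =>
      rw [Finset.sum_insert ha, Finset.sum_insert ha, ← ih]
      rfl
  rw [hc]
  simp only [signInd_apply]
  by_cases h : w ≠ [] ∧ compSigns w = s ∧ P w
  · have := hf w h.1 h.2.1 h.2.2
    simp [h.1, h.2.1, h.2.2, this]
  · rw [if_neg h, Finset.sum_eq_zero]
    exact fun k _ => if_neg fun h' => h ⟨h'.1, h'.2.1, h'.2.2.1⟩

theorem exists_append_cons_of_lt_length {s : List Ordering} {k : ℕ} (hk : k < s.length) :
    ∃ s₁ c s₂, s = s₁ ++ c :: s₂ ∧ s₁.length = k :=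
  ⟨s.take k, s[k], s.drop (k + 1), by simp, by simp [hk.le]⟩

/-- Indicator series of words whose factorization at a given place has a prescribed sign there. -/
theorem signInd_mem_of_append {V : Submodule K (NCPoly K)} {s t : List Ordering} {c d : Ordering}
    {R : Word → Prop}
    (hd : ∀ (u v : Word) (hu : u ≠ []) (hv : v ≠ []), u.length = s.length + 1 → R (u ++ v) →
      compare (u.getLast hu) (v.head hv) = d)
    (h : c = d → signInd K (s ++ c :: t) R ∈ V) : signInd K (s ++ c :: t) R ∈ V := by
  by_cases hc : c = d
  · exact h hc
  · rw [signInd_eq_zero]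
    · exact V.zero_mem
    · intro w hw hs hR
      have hl := length_of_compSigns_eq hw hs
      rw [List.length_append, List.length_cons] at hl
      have hlen : (w.take (s.length + 1)).length = s.length + 1 := by
        rw [List.length_take]
        omega
      have hu : w.take (s.length + 1) ≠ [] := List.length_pos_iff.1 (by omega)
      have hv : w.drop (s.length + 1) ≠ [] := List.length_pos_iff.1 (by
        rw [List.length_drop]
        omega)
      rw [← List.take_append_drop (s.length + 1) w] at hs hR
      rw [compSigns_append_eq_iff hu hv hlen] at hs
      exact hc (hs.1.symm.trans (hd _ _ hu hv hlen hR))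

/-- Beyond length 1, a strict head forces the first sign to be `>`, and the series is then `M_1 ≺`
the sum of all words with the remaining signs. -/
theorem signInd_strictHead_mem {V : Submodule K (NCPoly K)} (hV : IsSubTrialgebra V)
    (h1 : M K [1] ∈ V) (s : List Ordering)
    (ih : ∀ t : List Ordering, t.length < s.length → signInd K t (fun _ => True) ∈ V) :
    signInd K s StrictHead ∈ V := by
  rw [M_one_eq_signInd] at h1
  cases s with
  | nil =>
    convert h1 using 1
    refine signInd_congr fun w hw hs => ?_
    have := length_of_compSigns_eq hw hs
    obtain ⟨a, rfl⟩ := List.length_eq_one_iff.1 this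
    simp [strictHead_cons]
  | cons c t =>
    refine signInd_mem_of_append (s := []) (d := .gt) ?_ ?_
    · intro u v hu hv hl hR
      obtain ⟨a, rfl⟩ := List.length_eq_one_iff.1 hl
      exact compare_gt_iff_gt.2 (strictHead_cons.1 hR _ (List.head_mem hv))
    · rintro rfl
      convert hV.left _ h1 _ (ih t (by simp)) using 1
      refine Subtype.ext (Eq.trans ?_ (coe_dendLeft _ _).symm)
      refine Eq.symm <| splitProd_signInd K fun u v hu hv hl => ?_
      rw [compSigns_append_eq_iff hu hv hl]
      obtain ⟨a, rfl⟩ := List.length_eq_one_iff.1 hl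
      simp only [List.singleton_append, strictHead_cons, List.maximum_singleton,
        maximum_lt_coe_iff, List.getLast_singleton]
      constructor
      · rintro ⟨⟨-, h2, h3⟩, h4⟩
        exact ⟨⟨hu, hv, h4⟩, ⟨h2, trivial⟩, h3, trivial⟩
      · rintro ⟨⟨-, -, h4⟩, ⟨h2, -⟩, h3, -⟩
        exact ⟨⟨compare_gt_iff_gt.2 (h4 _ (List.head_mem hv)), h2, h3⟩, h4⟩

/-- Sorting by the second occurrence of the maximum turns each part into a strict-head series `∘` a
shorter weak-head series, except the part without a second occurrence, which is the strict-head
series. -/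
theorem signInd_weakHead_mem {V : Submodule K (NCPoly K)} (hV : IsSubTrialgebra V)
    (s : List Ordering)
    (hs : ∀ t : List Ordering, t.length ≤ s.length → signInd K t StrictHead ∈ V)
    (ih : ∀ t : List Ordering, t.length < s.length → signInd K t WeakHead ∈ V) :
    signInd K s WeakHead ∈ V := by
  rw [signInd_eq_sum (f := secondIdx) (n := s.length + 2)]
  · refine V.sum_mem fun k hk => ?_
    rw [Finset.mem_range] at hk
    rcases Nat.eq_zero_or_pos k with rfl | hpos
    · rw [signInd_eq_zero]
      · exact V.zero_mem
      · rintro w hw - ⟨-, h⟩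
        obtain ⟨m, v, rfl⟩ := List.exists_cons_of_ne_nil hw
        simp [secondIdx] at h
    obtain ⟨k, rfl⟩ := Nat.exists_eq_add_of_le' hpos
    -- The index is now `k + 1`; equality means that it is the word length, i.e. the maximum does
    -- not recur.
    by_cases hks : k = s.length
    · convert hs s le_rfl using 1
      refine signInd_congr fun w hw hw' => ?_
      rw [hks, ← length_of_compSigns_eq hw hw']
      exact weakHead_secondIdx_eq_length_iff hw
    · obtain ⟨s, c, t, rfl, rfl⟩ := exists_append_cons_of_lt_length (s := s) (k := k) (by omega)
      have hR : ∀ u v : Word, u ≠ [] → v ≠ [] → u.length = s.length + 1 →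
          (WeakHead (u ++ v) ∧ secondIdx (u ++ v) = s.length + 1 ↔
            u.maximum = v.maximum ∧ StrictHead u ∧ WeakHead v) := by
        intro u v hu hv hl
        rw [← hl]
        exact weakHead_secondIdx_append_iff hu hv
      have hd : ∀ (u v : Word) (hu : u ≠ []) (hv : v ≠ []), u.length = s.length + 1 →
          WeakHead (u ++ v) ∧ secondIdx (u ++ v) = s.length + 1 →
          compare (u.getLast hu) (v.head hv) = if s.length + 1 = 1 then .eq else .lt := by
        intro u v hu hv hl h
        obtain ⟨h1, h2, h3⟩ := (hR u v hu hv hl).1 h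
        rw [compare_of_maximum_eq hu hv h1 h2 h3, hl]
      refine signInd_mem_of_append hd ?_
      intro hc
      convert hV.mid _ (hs s (by simp)) _ (ih t (by simp; omega)) using 1
      refine Subtype.ext (Eq.trans ?_ (coe_dendMid _ _).symm)
      refine Eq.symm <| splitProd_signInd K fun u v hu hv hl => ?_
      have hR' := hR u v hu hv hl
      have hd' := hd u v hu hv hl
      rw [← hc] at hd'
      rw [compSigns_append_eq_iff hu hv hl]
      tauto
  · intro w hw hw' _
    have := secondIdx_le_length w
    have := length_of_compSigns_eq hw hw'
    omega

/-- Sorting by the first occurrence of the maximum: at position 0 the word has a weak head,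
otherwise the part is a shorter full series `≻` a weak-head series. -/
theorem signInd_mem {V : Submodule K (NCPoly K)} (hV : IsSubTrialgebra V)
    (s : List Ordering)
    (hs : ∀ t : List Ordering, t.length ≤ s.length → signInd K t WeakHead ∈ V)
    (ih : ∀ t : List Ordering, t.length < s.length → signInd K t (fun _ => True) ∈ V) :
    signInd K s (fun _ => True) ∈ V := by
  rw [signInd_eq_sum (f := maxIdx) (n := s.length + 1)]
  · refine V.sum_mem fun k hk => ?_
    rw [Finset.mem_range] at hk
    rcases Nat.eq_zero_or_pos k with rfl | hpos
    · convert hs s le_rfl using 1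
      refine signInd_congr fun w hw hw' => ?_
      rw [maxIdx_eq_zero_iff hw, true_and]
    obtain ⟨k, rfl⟩ := Nat.exists_eq_add_of_le' hpos
    obtain ⟨s, c, t, rfl, rfl⟩ := exists_append_cons_of_lt_length (s := s) (k := k) (by omega)
    have hR : ∀ u v : Word, v ≠ [] → u.length = s.length + 1 →
        (maxIdx (u ++ v) = s.length + 1 ↔ u.maximum < v.maximum ∧ WeakHead v) := by
      intro u v hv hl
      rw [← hl]
      exact maxIdx_append_iff hv
    have hd : ∀ (u v : Word) (hu : u ≠ []) (hv : v ≠ []), u.length = s.length + 1 →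
        True ∧ maxIdx (u ++ v) = s.length + 1 → compare (u.getLast hu) (v.head hv) = .lt := by
      intro u v hu hv hl h
      obtain ⟨h1, h2⟩ := (hR u v hv hl).1 h.2
      exact compare_of_maximum_lt hu hv h1 h2
    refine signInd_mem_of_append hd ?_
    rintro rfl
    convert hV.right _ (ih s (by simp)) _ (hs t (by simp; omega)) using 1
    refine Subtype.ext (Eq.trans ?_ (coe_dendRight _ _).symm)
    refine Eq.symm <| splitProd_signInd K fun u v hu hv hl => ?_
    have hR' := hR u v hv hl
    have hd' := hd u v hu hv hl
    rw [compSigns_append_eq_iff hu hv hl]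
    tauto
  · intro w hw hw' _
    have := maxIdx_lt_length hw
    have := length_of_compSigns_eq hw hw'
    omega

theorem MC_mem_TD (I : SegComp) : MC K I ∈ TD K := by
  refine Submodule.mem_sInf.2 fun V hV => ?_
  -- For each number of signs the order matters: strict heads use shorter full series, weak heads
  -- use strict heads of the same length, and full series use weak heads of the same length.
  have key : ∀ n, ∀ s : List Ordering, s.length < n → signInd K s StrictHead ∈ V ∧
      signInd K s WeakHead ∈ V ∧ signInd K s (fun _ => True) ∈ V := by
    intro n
    induction n with
    | zero => simp
    | succ n ih =>
      have hs : ∀ s : List Ordering, s.length < n + 1 → signInd K s StrictHead ∈ V :=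
        fun s hs => signInd_strictHead_mem hV.1 hV.2 s fun t ht => (ih t (by omega)).2.2
      have hw : ∀ s : List Ordering, s.length < n + 1 → signInd K s WeakHead ∈ V :=
        fun s hs' => signInd_weakHead_mem hV.1 s (fun t ht => hs t (by omega))
          fun t ht => (ih t (by omega)).2.1
      exact fun s hs' => ⟨hs s hs', hw s hs',
        signInd_mem hV.1 s (fun t ht => hw t (by omega)) fun t ht => (ih t (by omega)).2.2⟩
  rw [MC_eq_signInd]
  exact (key _ _ (Nat.lt_succ_self _)).2.2

end TD

/-! ### `TC` as a cubical trialgebra -/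

/-- The comparison sign attached to an operation of a cubical trialgebra. -/
def CubOp.sign : CubOp → Ordering
  | .left => .gt
  | .mid => .eq
  | .right => .lt

/-- The operation of a cubical trialgebra attached to a comparison sign. -/
def CubOp.ofSign : Ordering → CubOp
  | .gt => .left
  | .eq => .mid
  | .lt => .right

theorem CubOp.sign_ofSign (c : Ordering) : (CubOp.ofSign c).sign = c := by cases c <;> rfl

theorem CubOp.ofSign_sign (i : CubOp) : CubOp.ofSign i.sign = i := by cases i <;> rfl

/-- The concatenation of segmented compositions along the sign of an operation. -/
def SegComp.join (i : CubOp) (I J : SegComp) : SegComp :=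
  SegComp.signEquiv.symm (I.signs ++ i.sign :: J.signs)

theorem SegComp.signs_join (i : CubOp) (I J : SegComp) :
    (SegComp.join i I J).signs = I.signs ++ i.sign :: J.signs := SegComp.signs_ofSigns _

theorem SegComp.signs_injective : Function.Injective SegComp.signs := SegComp.signEquiv.injective

theorem SegComp.join_assoc (i j : CubOp) (I J L : SegComp) :
    join j (join i I J) L = join i I (join j J L) := by
  apply SegComp.signs_injective
  simp [signs_join]

theorem SegComp.join_right (I J : SegComp) : join .right I J = I.glue J :=
  SegComp.signs_injective (by rw [signs_join, signs_glue]; rfl)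

theorem SegComp.join_mid (I J : SegComp) : join .mid I J = concat .comma I J :=
  SegComp.signs_injective (by rw [signs_join, signs_concat]; rfl)

theorem SegComp.join_left (I J : SegComp) : join .left I J = concat .bar I J :=
  SegComp.signs_injective (by rw [signs_join, signs_concat]; rfl)

/-- Induction along the sequence of signs: every segmented composition is obtained from `(1)` by
successively putting `(1)` in front. -/
theorem SegComp.join_induction {p : SegComp → Prop} (one : p .one)
    (join : ∀ i I, p I → p (.join i .one I)) (I : SegComp) : p I := by
  obtain ⟨s, rfl⟩ := SegComp.signEquiv.symm.surjective I
  induction s with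
  | nil => exact one
  | cons c s ih =>
    have h := join (.ofSign c) _ ih
    have : SegComp.join (.ofSign c) .one (signEquiv.symm s) = signEquiv.symm (c :: s) := by
      apply SegComp.signs_injective
      rw [signs_join, CubOp.sign_ofSign]
      change [] ++ c :: (ofSigns s).signs = (ofSigns (c :: s)).signs
      rw [signs_ofSigns, signs_ofSigns]
      rfl
    rwa [this] at h

/-! ### The basis of `TC`, its operations and freeness -/

section TC

variable {K : Type u} [CommRing K]

/-- By the product rule the span is already closed under multiplication. -/
theorem toSubmodule_TC : (TC K).toSubmodule = Submodule.span K (Set.range (MC K)) := by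
  apply le_antisymm
  · let S : NonUnitalSubalgebra K (NCPoly K) :=
      { Submodule.span K (Set.range (MC K)) with
        mul_mem' := fun {x y} hx hy => by
          refine Submodule.span_induction₂ (p := fun x y _ _ =>
            x * y ∈ Submodule.span K (Set.range (MC K))) ?_ ?_ ?_ ?_ ?_ ?_ ?_ hx hy
          · rintro _ _ ⟨I, rfl⟩ ⟨J, rfl⟩
            rw [MC_mul_MC]
            exact add_mem (add_mem (Submodule.subset_span ⟨_, rfl⟩)
              (Submodule.subset_span ⟨_, rfl⟩)) (Submodule.subset_span ⟨_, rfl⟩)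
          · intro y _
            rw [zero_mul]
            exact zero_mem _
          · intro x _
            rw [mul_zero]
            exact zero_mem _
          · intro x y z _ _ _ h1 h2
            rw [add_mul]
            exact add_mem h1 h2
          · intro x y z _ _ _ h1 h2
            rw [mul_add]
            exact add_mem h1 h2
          · intro c x y _ _ h
            rw [smul_mul_assoc]
            exact Submodule.smul_mem _ _ h
          · intro c x y _ _ h
            rw [mul_smul_comm]
            exact Submodule.smul_mem _ _ h }
    exact NonUnitalAlgebra.adjoin_le (S := S) Submodule.subset_span
  · exact Submodule.span_le.2 (NonUnitalAlgebra.subset_adjoin K)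

variable (K) in
/-- The basis `MC_I` of `TC`. -/
noncomputable def basisTC : Module.Basis SegComp K ↥(TC K) :=
  (Module.Basis.span (linearIndependent_MC (K := K))).map
    (LinearEquiv.ofEq _ _ toSubmodule_TC.symm)

theorem basisTC_apply (I : SegComp) : basisTC K I = mc K I := by
  refine Subtype.ext ?_
  change ((LinearEquiv.ofEq _ _ toSubmodule_TC.symm (Module.Basis.span
    (linearIndependent_MC (K := K)) I) : (TC K).toSubmodule) : NCPoly K) = MC K I
  rw [LinearEquiv.coe_ofEq_apply, Module.Basis.span_apply]

/-- The bilinear operation on `TC` that sends `MC_I, MC_J` to the `MC` of their concatenation along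
the sign of the operation. -/
noncomputable def opTC (i : CubOp) : ↥(TC K) →ₗ[K] ↥(TC K) →ₗ[K] ↥(TC K) :=
  (basisTC K).constr K fun I => (basisTC K).constr K fun J => mc K (.join i I J)

theorem opTC_mc (i : CubOp) (I J : SegComp) :
    opTC i (mc K I) (mc K J) = mc K (.join i I J) := by
  rw [← basisTC_apply, ← basisTC_apply, opTC, Module.Basis.constr_basis,
    Module.Basis.constr_basis]

/-- Two bilinear maps on `TC` that agree on the `MC_I` are equal. -/
theorem bilinear_ext_TC {W : Type*} [AddCommGroup W] [Module K W]
    {f g : ↥(TC K) →ₗ[K] ↥(TC K) →ₗ[K] W}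
    (h : ∀ I J, f (mc K I) (mc K J) = g (mc K I) (mc K J)) : f = g := by
  refine (basisTC K).ext fun I => (basisTC K).ext fun J => ?_
  rw [basisTC_apply, basisTC_apply, h]

variable (K) in
/-- The cubical trialgebra structure of `TC`. -/
noncomputable def cubicalTC : CubicalTrialgebra K ↥(TC K) where
  op := opTC
  assoc := fun i j x y z => by
    -- Trilinearity in two stages: with `z` fixed, `x` and `y` are reduced to basis elements; `hz`
    -- then does the same for `z`.
    have h : (opTC i).compr₂ ((opTC j).flip z) = (opTC i).compl₂ ((opTC j).flip z) := by
      refine bilinear_ext_TC fun I J => ?_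
      have hz : opTC j (mc K (.join i I J)) = (opTC i (mc K I)).comp (opTC j (mc K J)) := by
        refine (basisTC K).ext fun L => ?_
        simp only [LinearMap.comp_apply, basisTC_apply, opTC_mc, SegComp.join_assoc]
      simpa [opTC_mc] using LinearMap.congr_fun hz z
    exact LinearMap.congr_fun (LinearMap.congr_fun h x) y

theorem mul_TC (x y : ↥(TC K)) : x * y = opTC .left x y + opTC .mid x y + opTC .right x y := by
  have h : LinearMap.mul K ↥(TC K) = opTC .left + opTC .mid + opTC .right := by
    refine bilinear_ext_TC fun I J => Subtype.ext ?_
    simp only [LinearMap.mul_apply', LinearMap.add_apply, opTC_mc, SegComp.join_right,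
      SegComp.join_mid, SegComp.join_left]
    refine (MC_mul_MC I J).trans ?_
    change _ = MC K _ + MC K _ + MC K _
    abel
  exact LinearMap.congr_fun (LinearMap.congr_fun h x) y

/-- The element of a cubical trialgebra obtained from `b` by applying the operations given by a
sequence of signs. -/
def CubicalTrialgebra.evalSigns {W : Type*} [AddCommGroup W] [Module K W]
    (S : CubicalTrialgebra K W) (b : W) : List Ordering → W
  | [] => b
  | c :: s => S.op (.ofSign c) b (S.evalSigns b s)

/-- Evaluation is right-nested, and associativity for each pair of operations moves the bracket past
one sign of `s` at a time. -/
theorem CubicalTrialgebra.evalSigns_append {W : Type*} [AddCommGroup W] [Module K W]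
    (S : CubicalTrialgebra K W) (b : W) (i : CubOp) (s t : List Ordering) :
    S.evalSigns b (s ++ i.sign :: t) = S.op i (S.evalSigns b s) (S.evalSigns b t) := by
  induction s with
  | nil => simp [evalSigns, CubOp.ofSign_sign]
  | cons c s ih => simp only [List.cons_append, evalSigns, ih, S.assoc]

theorem isFreeOn_cubicalTC : CubicalTrialgebra.IsFreeOn.{w} (cubicalTC K) (mc K .one) := by
  intro W _ _ S b
  let φ : ↥(TC K) →ₗ[K] W := (basisTC K).constr K fun I => S.evalSigns b I.signs
  have hφ : ∀ I, φ (mc K I) = S.evalSigns b I.signs := fun I => by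
    rw [← basisTC_apply, Module.Basis.constr_basis]
  refine ⟨φ, ⟨fun i x y => ?_, hφ _⟩, fun ψ hψ => ?_⟩
  · have h : (opTC i).compr₂ φ = (S.op i).compl₁₂ φ φ := by
      refine bilinear_ext_TC fun I J => ?_
      simp only [LinearMap.compr₂_apply, LinearMap.compl₁₂_apply, opTC_mc, hφ,
        SegComp.signs_join, CubicalTrialgebra.evalSigns_append]
    exact LinearMap.congr_fun (LinearMap.congr_fun h x) y
  -- Uniqueness: each basis element is the generator joined to a shorter one, so its image is
  -- forced.
  · refine (basisTC K).ext fun I => ?_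
    rw [basisTC_apply]
    induction I using SegComp.join_induction with
    | one => exact hψ.2.trans (hφ .one).symm
    | join i I ih =>
      rw [← opTC_mc]
      refine (hψ.1 i _ _).trans ?_
      rw [hψ.2, ih, opTC_mc, hφ, hφ, SegComp.signs_join, CubicalTrialgebra.evalSigns_append]
      rfl

end TC

end WQ

/-- The `MC_I` span a subalgebra `TC` of `TD`, with the stated product rule; the three terms of the
product rule define three operations that split the product of `TC`, and with them `TC` is the free
cubical trialgebra on the generator `MC_1 = M_1`. -/
theorem mainTheorem5 (K : Type u) [Field K] [CharZero K] :
    WQ.TC K ≤ WQ.TD K ∧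
    (WQ.TC K).toSubmodule = Submodule.span K (Set.range (WQ.MC K)) ∧
    LinearIndependent K (WQ.MC K) ∧
    (∀ I J : WQ.SegComp,
      WQ.MC K I * WQ.MC K J
        = WQ.MC K (I.glue J) + WQ.MC K (.concat .comma I J) + WQ.MC K (.concat .bar I J)) ∧
    WQ.MC K .one = WQ.M K [1] ∧
    ∃ T : WQ.CubicalTrialgebra K ↥(WQ.TC K),
      (∀ I J : WQ.SegComp,
        T.op .right (WQ.mc K I) (WQ.mc K J) = WQ.mc K (I.glue J) ∧
        T.op .mid (WQ.mc K I) (WQ.mc K J) = WQ.mc K (.concat .comma I J) ∧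
        T.op .left (WQ.mc K I) (WQ.mc K J) = WQ.mc K (.concat .bar I J)) ∧
      (∀ x y : ↥(WQ.TC K), x * y = T.op .left x y + T.op .mid x y + T.op .right x y) ∧
      WQ.CubicalTrialgebra.IsFreeOn.{w} T (WQ.mc K .one) := by
  refine ⟨NonUnitalAlgebra.adjoin_le ?_, WQ.toSubmodule_TC, WQ.linearIndependent_MC,
    WQ.MC_mul_MC, (WQ.MC_eq_signInd _).trans WQ.M_one_eq_signInd.symm, WQ.cubicalTC K,
    fun I J => ⟨?_, ?_, ?_⟩, WQ.mul_TC, WQ.isFreeOn_cubicalTC⟩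
  · rintro _ ⟨I, rfl⟩
    exact WQ.MC_mem_TD I
  · exact (WQ.opTC_mc _ I J).trans (congrArg _ (WQ.SegComp.join_right I J))
  · exact (WQ.opTC_mc _ I J).trans (congrArg _ (WQ.SegComp.join_mid I J))
  · exact (WQ.opTC_mc _ I J).trans (congrArg _ (WQ.SegComp.join_left I J))
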